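/- Let $\mathcal{A} = \langle Q, \Sigma, \delta\rangle$ be a finite deterministic complete automaton with $n = |Q|$ states, and for $q \in Q$ and a word $w \in \Sigma^*$ let $qw$ denote the state reached from $q$ by reading $w$. Suppose that $\mathcal{A}$ is synchronizing, i.e. it has a reset word (a word $w$ such that $qw$ is the same state for all $q \in Q$), and that $\mathcal{A}$ is one-cluster, i.e. there is a letter $a \in \Sigma$ such that for every pair $q, s \in Q$ there are $i, j \ge 1$ with $qa^i = sa^j$. For any such letter $a$, let $m$ be the length of the unique cycle of the transformation $q \mapsto qa$, that is, the number of states $q \in Q$ with $qa^i = q$ for some $i \ge 1$. Then $\mathcal{A}$ has a reset word of length at most $$2nm - 4m\ln\frac{m+3}{2} + 2m - n + 1.$$ -/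

import Mathlib

/-- A complete deterministic automaton (without initial and final states) with state set `Q`,
input alphabet `A` and transition function `δ`. -/
structure Automaton (Q A : Type*) where
  /-- The transition function. -/
  δ : Q → A → Q

namespace Automaton

/-- The state `q w` reached from the state `q` by reading the word `w` from left to right. -/
def run {Q A : Type*} (M : Automaton Q A) (q : Q) (w : List A) : Q :=
  w.foldl M.δ q

/-- The word `w` is a reset word: it sends all states to one and the same state. -/
def IsResetWord {Q A : Type*} (M : Automaton Q A) (w : List A) : Prop :=
  ∃ r : Q, ∀ q : Q, M.run q w = r

/-- The automaton is synchronizing: it has a reset word. -/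
def IsSynchronizing {Q A : Type*} (M : Automaton Q A) : Prop :=
  ∃ w : List A, M.IsResetWord w

/-- The transformation `q ↦ q a` of the state set induced by the letter `a`. -/
def letterMap {Q A : Type*} (M : Automaton Q A) (a : A) : Q → Q :=
  fun q => M.δ q a

/-- The letter `a` witnesses that the automaton is one-cluster: for every pair of states `q, s`
there are `i, j ≥ 1` with `q a ^ i = s a ^ j`. -/
def IsOneClusterLetter {Q A : Type*} (M : Automaton Q A) (a : A) : Prop :=
  ∀ q s : Q, ∃ i j : ℕ, 1 ≤ i ∧ 1 ≤ j ∧ (M.letterMap a)^[i] q = (M.letterMap a)^[j] s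

/-- The states lying on cycles of the letter `a`, that is, the states `q` with `q a ^ i = q` for
some `i ≥ 1`. For a one-cluster letter on a finite nonempty state set they form the unique cycle
of `a`. -/
def cycle {Q A : Type*} (M : Automaton Q A) (a : A) : Set Q :=
  Function.periodicPts (M.letterMap a)

end Automaton

/-!
Let `C` be the cycle of `a`, of length `m`, and let `N = n - m`, so that `a ^ N` maps all states into
`C`. Starting from one state of `C`, preimages under suitable words are taken until the preimage
contains `C`; a final factor `a ^ N` in front then gives a reset word. The point is the length of the
word needed to enlarge the trace on `C` of a set `S` that meets `C` in `k` states, `0 < k < m`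
(`Automaton.exists_extension`).

Reading `S` along the cycle gives a cyclic word; let `p` be its least period, a divisor of `m`. The
indicators of the preimages of `S` under `a ^ (N + j)`, shifted by the constant `k / m`, span a space
`V` of functions on the states, and the functional `φ` that sums over `C` vanishes on `V`.
As the automaton is synchronizing, `φ` does not vanish on all translates of `V` by words, and by the
usual ascending chain argument (`Automaton.exists_short_word`) a word `u` with
`|u| + dim V ≤ n` is enough to see this. For that `u` the preimages of `S` under `u a ^ (N + j)` do
not all have `k` states in `C`. Their mean size over `j < p` is `k`, because every state runs through
the whole cycle, so one of them is larger than `k`. The word has length at most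
`2 n - (dim V + 1) - (m - p)`.

A lower bound for `dim V` comes from counting (`two_mul_minimalPeriod_le`). A basis of `V` made of
`dim V` of the generators separates the `p` cyclic shifts of the word, so among the `p` distinct
zero-one columns read off at these generators at most one is zero and at most `dim V` have weight
one. Comparing with the total weight gives `2 p ≤ (dim V + 1) (κ + 1)`, where `κ` is the number of
ones, or of zeros, in one period. Hence an extension costs at most
`2 n - 2 m / (min k (m - k) + 1)`, whether or not the word has a period shorter than `m`
(`extension_cost_le`). In the first extension, from a single state, the target may be replaced by
another state of the cycle, which saves a further `m - 1` letters
(`Automaton.exists_first_extension`). Summation over `k`, with harmonic sums bounded below by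
logarithms (`two_mul_log_sub_one_le_sum`), gives the bound.
-/

/-! ### Zero-one sequences: counting columns and periods -/

open Finset in
/-- Words of zeros and ones are counted by weight: at most one of the `p` columns has weight `0`,
at most `#J` of them have weight `1`, and all others have weight at least `2`. -/
theorem two_mul_le_of_injOn_columns (s : ℕ → Prop) [DecidablePred s] (J : Finset ℕ) (p k : ℕ)
    (hcol : ∀ t < p, ∀ t' < p, (∀ j ∈ J, (s (t + j) ↔ s (t' + j))) → t = t')
    (hk : ∀ j, #{t ∈ range p | s (t + j)} = k) :
    2 * p ≤ #J * (k + 1) + 2 := by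
  classical
  have hinj : Set.InjOn (fun t ↦ {j ∈ J | s (t + j)}) (range p : Finset ℕ) := by
    intro t ht t' ht' h
    refine hcol t (by simpa using ht) t' (by simpa using ht') fun j hj ↦ ?_
    have := congrArg (j ∈ ·) h
    simpa [hj] using this
  have hbd (i : ℕ) : #{t ∈ range p | #{j ∈ J | s (t + j)} = i} ≤ (#J).choose i := by
    rw [← card_powersetCard]
    refine card_le_card_of_injOn (fun t ↦ {j ∈ J | s (t + j)}) ?_ (hinj.mono ?_)
    · intro t ht
      simp only [coe_filter, Set.mem_ofPred_eq] at ht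
      simp [mem_powersetCard, ht.2, filter_subset]
    · exact_mod_cast filter_subset _ _
  have h0 := hbd 0
  have h1 := hbd 1
  simp only [Nat.choose_zero_right, Nat.choose_one_right] at h0 h1
  have hsum : ∑ t ∈ range p, #{j ∈ J | s (t + j)} = #J * k := by
    simp only [card_filter]
    rw [sum_comm]
    simp only [← card_filter, hk, sum_const, smul_eq_mul]
  have hpt : ∑ t ∈ range p, 2 ≤ ∑ t ∈ range p, (#{j ∈ J | s (t + j)}
      + (if #{j ∈ J | s (t + j)} = 1 then 1 else 0)
      + 2 * (if #{j ∈ J | s (t + j)} = 0 then 1 else 0)) := by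
    refine sum_le_sum fun t _ ↦ ?_
    split_ifs <;> omega
  rw [sum_add_distrib, sum_add_distrib, hsum, ← mul_sum, ← card_filter, ← card_filter] at hpt
  simp only [sum_const, card_range, smul_eq_mul] at hpt
  nlinarith

open Finset in
theorem card_filter_shift_of_periodic (s : ℕ → Prop) [DecidablePred s] (p : ℕ)
    (hp : ∀ t, s (t + p) ↔ s t) (j : ℕ) :
    #{t ∈ range p | s (t + j)} = #{t ∈ range p | s t} := by
  induction j with
  | zero => simp
  | succ j ih =>
    rw [← ih]
    simp only [card_filter]
    have h1 := sum_range_succ (fun t ↦ if s (t + j) then 1 else 0) p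
    have h2 := sum_range_succ' (fun t ↦ if s (t + j) then 1 else 0) p
    have h3 : s (p + j) ↔ s (0 + j) := by rw [add_comm p, hp, zero_add]
    simp only [h3] at h1
    rw [h1] at h2
    have := Nat.add_right_cancel h2
    rw [this]
    refine sum_congr rfl fun t _ ↦ ?_
    rw [show t + (j + 1) = t + 1 + j by ring]

open Finset in
theorem card_filter_range_mul_of_periodic (s : ℕ → Prop) [DecidablePred s] (p : ℕ)
    (hp : ∀ t, s (t + p) ↔ s t) (h : ℕ) :
    #{t ∈ range (p * h) | s t} = #{t ∈ range p | s t} * h := by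
  induction h with
  | zero => simp
  | succ h ih =>
    have := card_filter_shift_of_periodic s p hp (p * h)
    simp only [card_filter] at *
    rw [mul_add, mul_one, sum_range_add, ih, mul_add, mul_one, ← this]
    simp only [add_comm]

/-- The shift on sequences, whose periodic points are the periodic sequences. -/
def seqShift (s : ℕ → Prop) : ℕ → Prop := fun t ↦ s (t + 1)

theorem seqShift_iterate (s : ℕ → Prop) (i : ℕ) : seqShift^[i] s = fun t ↦ s (t + i) := by
  induction i with
  | zero => rfl
  | succ i ih =>
    rw [Function.iterate_succ_apply', ih]
    funext t
    simp only [seqShift]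
    congr 1
    ring

/-! ### Linear functionals and words of minimal length -/

namespace Automaton

variable {Q A : Type*} (M : Automaton Q A)

theorem run_append (q : Q) (u w : List A) : M.run q (u ++ w) = M.run (M.run q u) w := by
  simp [run]

theorem run_replicate (q : Q) (a : A) (i : ℕ) :
    M.run q (List.replicate i a) = (M.letterMap a)^[i] q := by
  induction i generalizing q with
  | zero => rfl
  | succ i ih =>
    rw [Function.iterate_succ_apply, ← ih]
    rfl

/-- The span of the functions `g ∘ u` where `g` lies in `G` and `u` runs over the transformations
of the state set induced by the words of length at most `i`. -/
def wordSpan (G : Set (Q → ℝ)) (i : ℕ) : Submodule ℝ (Q → ℝ) :=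
  Submodule.span ℝ {x | ∃ g ∈ G, ∃ u : List A, u.length ≤ i ∧ x = fun q ↦ g (M.run q u)}

theorem wordSpan_mono (G : Set (Q → ℝ)) : Monotone (M.wordSpan G) := by
  intro i j hij
  refine Submodule.span_mono ?_
  rintro x ⟨g, hg, u, hu, rfl⟩
  exact ⟨g, hg, u, hu.trans hij, rfl⟩

theorem comp_letter_mem_wordSpan (G : Set (Q → ℝ)) (i : ℕ) (b : A) {x : Q → ℝ}
    (hx : x ∈ M.wordSpan G i) : (fun q ↦ x (M.δ q b)) ∈ M.wordSpan G (i + 1) := by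
  have : M.wordSpan G i ≤
      (M.wordSpan G (i + 1)).comap (LinearMap.funLeft ℝ ℝ fun q ↦ M.δ q b) := by
    refine Submodule.span_le.2 ?_
    rintro x ⟨g, hg, u, hu, rfl⟩
    exact Submodule.subset_span ⟨g, hg, b :: u, by simpa using hu, rfl⟩
  exact this hx

theorem wordSpan_le_of_stable (G : Set (Q → ℝ)) (i : ℕ)
    (h : M.wordSpan G (i + 1) ≤ M.wordSpan G i) (j : ℕ) : M.wordSpan G j ≤ M.wordSpan G i := by
  induction j with
  | zero => exact M.wordSpan_mono G (Nat.zero_le i)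
  | succ j ih =>
    refine Submodule.span_le.2 ?_
    rintro x ⟨g, hg, u, hu, rfl⟩
    cases u with
    | nil => exact Submodule.subset_span ⟨g, hg, [], by simp, rfl⟩
    | cons b u =>
      refine h (M.comp_letter_mem_wordSpan G i b (x := fun q ↦ g (M.run q u)) (ih ?_))
      exact Submodule.subset_span ⟨g, hg, u, by simpa using hu, rfl⟩

/-- If a linear functional does not vanish on all the functions `g ∘ u`, then a word `u` of minimal
length witnessing this is short: the spaces `wordSpan` grow strictly up to that length, since the
chain is constant from the first repetition on. -/
theorem exists_short_word [Fintype Q] (G : Set (Q → ℝ)) (φ : (Q → ℝ) →ₗ[ℝ] ℝ)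
    (h : ∃ u : List A, ∃ g ∈ G, φ (fun q ↦ g (M.run q u)) ≠ 0) :
    ∃ u : List A, u.length + Module.finrank ℝ (Submodule.span ℝ G) ≤ Fintype.card Q ∧
      ∃ g ∈ G, φ (fun q ↦ g (M.run q u)) ≠ 0 := by
  classical
  have hex : ∃ L, ∃ u : List A, u.length = L ∧ ∃ g ∈ G, φ (fun q ↦ g (M.run q u)) ≠ 0 := by
    obtain ⟨u, hu⟩ := h
    exact ⟨_, u, rfl, hu⟩
  obtain ⟨u, hu, g, hg, hne⟩ := Nat.find_spec hex
  have hmin : ∀ u' : List A, u'.length < Nat.find hex → ∀ g ∈ G,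
      φ (fun q ↦ g (M.run q u')) = 0 := by
    intro u' hu' g hg
    by_contra hc
    exact Nat.find_min hex hu' ⟨u', rfl, g, hg, hc⟩
  generalize Nat.find hex = L at hu hmin
  have hker : ∀ i < L, M.wordSpan G i ≤ LinearMap.ker φ := by
    intro i hi
    refine Submodule.span_le.2 ?_
    rintro x ⟨g, hg, u', hu', rfl⟩
    exact hmin u' (hu'.trans_lt hi) g hg
  have hlt : ∀ i < L, M.wordSpan G i < M.wordSpan G (i + 1) := by
    intro i hi
    refine lt_of_le_not_ge (M.wordSpan_mono G (Nat.le_succ i)) fun hle ↦ hne ?_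
    exact hker i hi (M.wordSpan_le_of_stable G i hle L
      (Submodule.subset_span ⟨g, hg, u, hu.le, rfl⟩))
  have hrank : ∀ i ≤ L, Module.finrank ℝ (Submodule.span ℝ G) + i ≤
      Module.finrank ℝ (M.wordSpan G i) := by
    intro i
    induction i with
    | zero =>
      intro _
      refine Submodule.finrank_mono (Submodule.span_mono fun g hg ↦ ?_)
      exact ⟨g, hg, [], le_rfl, rfl⟩
    | succ i ih =>
      intro hi
      have := Submodule.finrank_lt_finrank_of_lt (hlt i hi)
      have := ih (by omega)
      omega
  refine ⟨u, ?_, g, hg, hne⟩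
  have h1 := hrank L le_rfl
  have h2 := Submodule.finrank_le (M.wordSpan G L)
  rw [Module.finrank_fintype_fun_eq_card] at h2
  omega

end Automaton

/-! ### The dimension of the span of shifted indicators -/

/-- A basis extracted from a family of functions separates the same points as the family. -/
theorem exists_finset_card_eq_finrank_separating {ι Q : Type*} [Fintype Q] (v : ι → Q → ℝ) :
    ∃ J : Finset ι, J.card = Module.finrank ℝ (Submodule.span ℝ (Set.range v)) ∧
      ∀ q q' : Q, (∀ j ∈ J, v j q = v j q') → ∀ j, v j q = v j q' := by
  classical
  obtain ⟨κ, a, ha, hspan, hli⟩ := exists_linearIndependent' ℝ v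
  have : Finite κ := hli.finite
  have := Fintype.ofFinite κ
  refine ⟨Finset.univ.image a, ?_, fun q q' h j ↦ ?_⟩
  · rw [Finset.card_image_of_injective _ ha, ← hspan, finrank_span_eq_card hli]
    rfl
  · have hle : Submodule.span ℝ (Set.range v) ≤
        LinearMap.ker (LinearMap.proj (R := ℝ) (φ := fun _ : Q ↦ ℝ) q - LinearMap.proj q') := by
      rw [← hspan]
      refine Submodule.span_le.2 ?_
      rintro x ⟨i, rfl⟩
      simpa [sub_eq_zero] using h (a i) (by simp)
    simpa [sub_eq_zero] using hle (Submodule.subset_span ⟨j, rfl⟩)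

theorem iterate_add_mul_of_iterate_eq {Q : Type*} {f : Q → Q} {c : Q} {m : ℕ} (hc : f^[m] c = c)
    (i t : ℕ) : f^[i + t * m] c = f^[i] c := by
  rw [Function.iterate_add_apply, mul_comm, Function.iterate_mul, Function.iterate_fixed hc]

open Finset Classical in
/-- The indicators of the preimages of `S` under the iterates `f^[N + j]`, shifted by a constant,
span a space whose dimension is at least about `2 / (k + 1)` times the least period of the cyclic
word that `S` cuts out on the orbit of `c`, where `k` is the number of ones, or of zeros, in that
period. -/
theorem two_mul_minimalPeriod_le {Q : Type*} [Fintype Q] (f : Q → Q) (c : Q) (S : Set Q) (N : ℕ)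
    (e : ℝ) (p k : ℕ) (hp : p = Function.minimalPeriod seqShift fun t ↦ f^[N + t] c ∈ S)
    (hk : #{t ∈ range p | f^[N + t] c ∈ S} = k) (hk0 : 0 < k) (hkp : k < p) :
    2 * p ≤ (Module.finrank ℝ (Submodule.span ℝ (Set.range fun (j : ℕ) (q : Q) ↦
      (if f^[N + j] q ∈ S then 1 else 0) - e)) + 1) * (min k (p - k) + 1) := by
  obtain ⟨J, hJ, hsep⟩ := exists_finset_card_eq_finrank_separating fun (j : ℕ) (q : Q) ↦
    (if f^[N + j] q ∈ S then 1 else 0) - e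
  rw [← hJ]
  obtain ⟨s, hs⟩ : ∃ s : ℕ → Prop, s = fun t ↦ f^[N + t] c ∈ S := ⟨_, rfl⟩
  have hst (t : ℕ) : f^[N + t] c ∈ S ↔ s t := by rw [hs]
  simp only [hst] at hk
  rw [← hs] at hp
  have hsp : ∀ t, s (t + p) ↔ s t := by
    intro t
    have h1 := Function.isPeriodicPt_minimalPeriod seqShift s
    rw [← hp, Function.IsPeriodicPt, Function.IsFixedPt, seqShift_iterate] at h1
    exact iff_of_eq (congrFun h1 t)
  have hcol : ∀ t < p, ∀ t' < p, (∀ j ∈ J, (s (t + j) ↔ s (t' + j))) → t = t' := by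
    intro t ht t' ht' heq
    have key (j t : ℕ) : f^[N + j] (f^[t] c) ∈ S ↔ s (t + j) := by
      rw [← Function.iterate_add_apply, show N + j + t = N + (t + j) by ring, hst]
    simp only [sub_left_inj] at hsep
    have h1 := hsep (f^[t] c) (f^[t'] c) fun j hj ↦ by simp only [key, heq j hj]
    rw [hp] at ht ht'
    refine Function.iterate_injOn_Iio_minimalPeriod (f := seqShift) (x := s) ht ht' ?_
    simp only [seqShift_iterate]
    funext j
    have h2 := h1 j
    simp only [key] at h2
    rw [add_comm j, add_comm j]
    by_cases h3 : s (t + j) <;> by_cases h4 : s (t' + j)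
    · simp only [h3, h4]
    · simp only [h3, h4, if_true, if_false, one_ne_zero] at h2
    · simp only [h3, h4, if_true, if_false, zero_ne_one] at h2
    · simp only [h3, h4]
  have hcard1 := two_mul_le_of_injOn_columns s J p k hcol fun j ↦
    (card_filter_shift_of_periodic s p hsp j).trans hk
  have hcard2 := two_mul_le_of_injOn_columns (fun t ↦ ¬ s t) J p (p - k)
    (fun t ht t' ht' heq ↦ hcol t ht t' ht' fun j hj ↦ not_iff_not.1 (heq j hj)) (fun j ↦ by
      have h1 := card_filter_add_card_filter_not (s := range p) (fun t ↦ s (t + j))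
      rw [card_filter_shift_of_periodic s p hsp j, card_range, hk] at h1
      omega)
  rcases le_total k (p - k) with hle | hle
  · rw [min_eq_left hle]
    nlinarith
  · rw [min_eq_right hle]
    have : 1 ≤ p - k := by omega
    nlinarith

/-! ### A single extension -/

namespace Automaton

variable {Q A : Type*} (M : Automaton Q A)

open Finset Classical in
/-- Let `c` lie on a cycle of length `m` of `a` into which `a ^ N` maps all states. A set `S`
meeting the cycle in `k` states, where `0 < k < m`, meets it in fewer states than its preimage under
some word `u a ^ (N + j)`. Here `p` is the least period of the cyclic word that `S` cuts out
on the cycle, and `d - 1` is the dimension of the space spanned by the indicators, shifted by a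
constant, of the preimages of `S` under the powers `a ^ (N + j)`. -/
theorem exists_extension [Fintype Q] (hM : M.IsSynchronizing) (a : A) {c : Q} {m N : ℕ}
    (hm : 0 < m) (hc : (M.letterMap a)^[m] c = c)
    (hN : ∀ q, ∃ t, (M.letterMap a)^[N] q = (M.letterMap a)^[t] c) (S : Set Q) (k : ℕ)
    (hk : #{t ∈ range m | (M.letterMap a)^[t] c ∈ S} = k) (hk0 : 0 < k) (hkm : k < m) :
    ∃ (u : List A) (j d p h κ : ℕ), p * h = m ∧ κ * h = min k (m - k) ∧ 2 * p ≤ d * (κ + 1) ∧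
      u.length + d ≤ Fintype.card Q + 1 ∧ j < p ∧
      k < #{t ∈ range m | (M.letterMap a)^[N + j] (M.run ((M.letterMap a)^[t] c) u) ∈ S} := by
  set f := M.letterMap a with hf
  have hN' : ∀ q, ∃ t, ∀ j, f^[N + j] q = f^[N + (t + j)] c := by
    intro q
    obtain ⟨t, ht⟩ := hN q
    -- the exponent is raised by the multiple `N * m` of the period, so that `N` can be split off
    refine ⟨t + N * (m - 1), fun j ↦ ?_⟩
    have : N + (t + N * (m - 1) + j) = j + t + N * m := by
      obtain ⟨m, rfl⟩ : ∃ m', m = m' + 1 := ⟨m - 1, by omega⟩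
      rw [Nat.add_sub_cancel]
      ring
    rw [this, iterate_add_mul_of_iterate_eq hc, add_comm N j, Function.iterate_add_apply, ht,
      ← Function.iterate_add_apply]
  set s : ℕ → Prop := fun t ↦ f^[N + t] c ∈ S with hs
  have hsm : Function.IsPeriodicPt seqShift m s := by
    rw [Function.IsPeriodicPt, Function.IsFixedPt, seqShift_iterate]
    funext t
    simp only [hs]
    rw [show N + (t + m) = N + t + 1 * m by ring, iterate_add_mul_of_iterate_eq hc]
  obtain ⟨p, hp⟩ : ∃ p, p = Function.minimalPeriod seqShift s := ⟨_, rfl⟩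
  have hp0 : 0 < p := hp ▸ hsm.minimalPeriod_pos hm
  obtain ⟨h, hph⟩ : p ∣ m := hp ▸ hsm.minimalPeriod_dvd
  have hsp : ∀ t, s (t + p) ↔ s t := by
    intro t
    have h1 := Function.isPeriodicPt_minimalPeriod seqShift s
    rw [← hp, Function.IsPeriodicPt, Function.IsFixedPt, seqShift_iterate] at h1
    exact iff_of_eq (congrFun h1 t)
  set k' := #{t ∈ range p | s t} with hk'
  have hkk : k = k' * h := by
    rw [hk', ← card_filter_range_mul_of_periodic s p hsp, ← hph, ← hk]
    have := card_filter_shift_of_periodic (fun t ↦ f^[t] c ∈ S) m (fun t ↦ by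
      simpa using iff_of_eq (congrArg (· ∈ S) (iterate_add_mul_of_iterate_eq hc t 1))) N
    rw [← this]
    simp only [hs, add_comm]
  have hkp : k' ≤ p := by
    simpa using card_filter_le (range p) s
  have hm' : (m : ℝ) ≠ 0 := by positivity
  have hk'0 : 0 < k' := Nat.pos_of_ne_zero fun h0 ↦ by simp [hkk, h0] at hk0
  have hk'p : k' < p := lt_of_le_of_ne hkp fun h0 ↦ by
    rw [hkk, hph, h0] at hkm
    exact hkm.false
  have hrank := two_mul_minimalPeriod_le f c S N ((k : ℝ) / m) p k' hp hk'.symm hk'0 hk'p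
  set v : ℕ → Q → ℝ := fun j q ↦ (if f^[N + j] q ∈ S then 1 else 0) - (k : ℝ) / m with hv
  set φ : (Q → ℝ) →ₗ[ℝ] ℝ := ∑ t ∈ range m, LinearMap.proj (f^[t] c) with hφ
  have hφv : ∀ (u : List A) (j : ℕ), φ (fun q ↦ v j (M.run q u)) =
      (#{t ∈ range m | f^[N + j] (M.run (f^[t] c) u) ∈ S} : ℝ) - k := by
    intro u j
    simp only [hφ, hv, LinearMap.sum_apply, LinearMap.proj_apply, sum_sub_distrib, sum_const,
      card_range, nsmul_eq_mul, card_filter, Nat.cast_sum, Nat.cast_ite, Nat.cast_one,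
      Nat.cast_zero]
    field_simp
  obtain ⟨u, hu, _, ⟨j, rfl⟩, hne⟩ := M.exists_short_word (Set.range v) φ (by
    obtain ⟨w, r, hw⟩ := hM
    obtain ⟨t, ht⟩ := hN r
    obtain ⟨i, hi⟩ := card_pos.1 (hk.symm ▸ hk0)
    rw [mem_filter] at hi
    refine ⟨w, _, ⟨i + t * (m - 1), rfl⟩, ?_⟩
    have hin : f^[N + (i + t * (m - 1))] r ∈ S := by
      obtain ⟨m, rfl⟩ : ∃ m', m = m' + 1 := ⟨m - 1, by omega⟩
      rw [add_comm N, Function.iterate_add_apply, ht, ← Function.iterate_add_apply,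
        show i + t * (m + 1 - 1) + t = i + t * (m + 1) by simp only [Nat.add_sub_cancel]; ring,
        iterate_add_mul_of_iterate_eq hc]
      exact hi.2
    rw [hφv]
    simp only [hw, hin, filter_true, card_range]
    rw [sub_ne_zero]
    exact_mod_cast hkm.ne')
  rw [hφv, sub_ne_zero] at hne
  set F : ℕ → ℕ := fun j ↦ #{t ∈ range m | f^[N + j] (M.run (f^[t] c) u) ∈ S} with hF
  have hne' : F j ≠ k := by exact_mod_cast hne
  have hFp : Function.Periodic F p := by
    intro j
    simp only [hF]
    refine congrArg card (filter_congr fun t _ ↦ ?_)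
    obtain ⟨t', ht'⟩ := hN' (M.run (f^[t] c) u)
    rw [ht', ht', ← add_assoc t' j p]
    exact hsp (t' + j)
  -- every state passes through the whole cycle, so the mean of `F` over a period is `k`
  have hmean : ∑ j ∈ range p, F j = ∑ j ∈ range p, k := by
    simp only [hF, card_filter]
    rw [sum_comm]
    simp only [← card_filter]
    have : ∀ t ∈ range m, #{j ∈ range p | f^[N + j] (M.run (f^[t] c) u) ∈ S} = k' := by
      intro t _
      obtain ⟨t', ht'⟩ := hN' (M.run (f^[t] c) u)
      rw [hk', ← card_filter_shift_of_periodic s p hsp t']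
      refine congrArg card (filter_congr fun j _ ↦ ?_)
      rw [ht', add_comm t']
    rw [sum_congr rfl this]
    simp only [sum_const, card_range, smul_eq_mul]
    rw [hkk, hph]
    ring
  obtain ⟨i, hi, hik⟩ : ∃ i < p, k < F i := by
    by_contra! hle
    have := (sum_eq_sum_iff_of_le fun i hi ↦ hle i (mem_range.1 hi)).1 hmean (j % p)
      (mem_range.2 (Nat.mod_lt _ hp0))
    exact hne' (by rw [← this, hFp.map_mod_nat])
  refine ⟨u, i, _, p, h, min k' (p - k'), hph.symm, ?_, hrank, by omega, hi, hik⟩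
  rw [hkk, hph, Nat.mul_comm p h, Nat.mul_comm k' h, ← Nat.mul_sub, Nat.mul_min_mul_left,
    Nat.mul_comm]

end Automaton

/-! ### Harmonic sums and the cost of an extension -/

open Finset in
theorem log_add_two_sub_one_le_sum (r : ℕ) :
    Real.log (r + 2) - 1 ≤ ∑ i ∈ range r, 1 / ((i : ℝ) + 2) := by
  induction r with
  | zero =>
    have := Real.log_le_sub_one_of_pos (x := 2) (by norm_num)
    simp only [Nat.cast_zero, zero_add, range_zero, sum_empty]
    linarith
  | succ r ih =>
    rw [sum_range_succ]
    have h1 : (0 : ℝ) < (r : ℝ) + 2 := by positivity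
    have h2 := Real.log_le_sub_one_of_pos (x := ((r : ℝ) + 3) / (r + 2)) (by positivity)
    rw [Real.log_div (by positivity) (by positivity)] at h2
    have h3 : ((r : ℝ) + 3) / (r + 2) - 1 = 1 / (r + 2) := by field_simp; ring
    push_cast
    rw [show (r : ℝ) + 1 + 2 = r + 3 by ring]
    linarith

open Finset in
theorem sum_range_one_div_min (r e : ℕ) (he : e ≤ 1) :
    ∑ i ∈ range (r + e + r), 1 / ((min (i + 1) (r + e + r - i) : ℕ) + 1 : ℝ) =
      2 * ∑ i ∈ range r, 1 / ((i : ℝ) + 2) + e / ((r : ℝ) + 2) := by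
  have h1 : ∑ i ∈ range r, 1 / ((min (i + 1) (r + e + r - i) : ℕ) + 1 : ℝ) =
      ∑ i ∈ range r, 1 / ((i : ℝ) + 2) := by
    refine sum_congr rfl fun i hi ↦ ?_
    rw [mem_range] at hi
    rw [min_eq_left (by omega)]
    push_cast
    ring
  have h2 : ∑ i ∈ range r, 1 / ((min (r + e + i + 1) (r + e + r - (r + e + i)) : ℕ) + 1 : ℝ) =
      ∑ i ∈ range r, 1 / ((i : ℝ) + 2) := by
    rw [← sum_range_reflect]
    refine sum_congr rfl fun i hi ↦ ?_
    rw [mem_range] at hi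
    rw [show min (r + e + (r - 1 - i) + 1) (r + e + r - (r + e + (r - 1 - i))) = i + 1 by omega]
    push_cast
    ring
  have h3 : ∑ i ∈ range e, 1 / ((min (r + i + 1) (r + e + r - (r + i)) : ℕ) + 1 : ℝ) =
      e / ((r : ℝ) + 2) := by
    interval_cases e
    · simp
    · rw [sum_range_one, show min (r + 0 + 1) (r + 1 + r - (r + 0)) = r + 1 by omega]
      push_cast
      ring
  rw [sum_range_add, sum_range_add, h1, h2, h3]
  ring

open Finset in
theorem two_mul_log_sub_one_le_sum (m : ℕ) (hm : 0 < m) :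
    2 * (Real.log (((m : ℝ) + 3) / 2) - 1) ≤
      ∑ i ∈ Ico 1 m, 1 / ((min i (m - i) : ℕ) + 1 : ℝ) := by
  obtain ⟨r, e, he, rfl⟩ : ∃ r e, e ≤ 1 ∧ m = r + e + r + 1 :=
    ⟨(m - 1) / 2, (m - 1) % 2, by omega, by omega⟩
  have h := log_add_two_sub_one_le_sum r
  rw [sum_Ico_eq_sum_range, Nat.add_sub_cancel]
  have h1 : ∀ i, min (1 + i) (r + e + r + 1 - (1 + i)) = min (i + 1) (r + e + r - i) := by
    intro i
    omega
  simp only [h1]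
  rw [sum_range_one_div_min r e he]
  have h2 : (0 : ℝ) < (r : ℝ) + 2 := by positivity
  have h3 := Real.log_le_sub_one_of_pos (x := ((r : ℝ) + 2 + e / 2) / (r + 2)) (by positivity)
  rw [Real.log_div (by positivity) (by positivity)] at h3
  have h4 : ((r : ℝ) + 2 + e / 2) / (r + 2) - 1 = (e / (r + 2)) / 2 := by field_simp; ring
  have h5 : (((r + e + r + 1 : ℕ) : ℝ) + 3) / 2 = (r : ℝ) + 2 + e / 2 := by push_cast; ring
  rw [h5]
  linarith

/-- A period `p` shorter than the length `m = p * h` of the cycle is no loss: the lower rank `d` is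
made up for by the `p * h - p` letters saved in the exponent of `a`. -/
theorem extension_cost_le {d p h κ : ℕ} (hκ : 0 < κ) (hh : 0 < h) (hd : 2 * p ≤ d * (κ + 1)) :
    2 * ((p * h : ℕ) : ℝ) / ((κ * h : ℕ) + 1) ≤ d + (p * h : ℕ) - p := by
  rw [div_le_iff₀ (by positivity)]
  obtain ⟨h, rfl⟩ : ∃ h', h = h' + 1 := ⟨h - 1, by omega⟩
  obtain ⟨κ, rfl⟩ : ∃ κ', κ = κ' + 1 := ⟨κ - 1, by omega⟩
  have hd' : 2 * (p : ℝ) ≤ d * (κ + 1 + 1) := by exact_mod_cast hd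
  push_cast
  have h1 : (0 : ℝ) ≤ d * (κ + 1) * h := by positivity
  have h2 : (0 : ℝ) ≤ p * h * (κ * h + κ + h) := by positivity
  nlinarith

/-! ### The cycle of a one-cluster letter -/

theorem mem_periodicPts_of_iterate_eq {Q : Type*} {f : Q → Q} {q : Q} {i j : ℕ} (hij : i < j)
    (h : f^[i] q = f^[j] q) : f^[i] q ∈ Function.periodicPts f := by
  refine ⟨j - i, by omega, ?_⟩
  rw [Function.IsPeriodicPt, Function.IsFixedPt, ← Function.iterate_add_apply, h]
  congr 2
  omega

theorem iterate_mem_periodicPts {Q : Type*} {f : Q → Q} {q : Q} (h : q ∈ Function.periodicPts f) (i : ℕ) :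
    f^[i] q ∈ Function.periodicPts f := by
  obtain ⟨l, hl, h⟩ := h
  exact ⟨l, hl, h.apply_iterate i⟩

namespace Automaton

variable {Q A : Type*} (M : Automaton Q A)

theorem cycle_nonempty [Finite Q] [Nonempty Q] (a : A) : (M.cycle a).Nonempty := by
  obtain ⟨q⟩ := ‹Nonempty Q›
  obtain ⟨i, j, hne, h⟩ := Finite.exists_ne_map_eq_of_infinite fun i : ℕ ↦ (M.letterMap a)^[i] q
  rcases hne.lt_or_gt with hij | hij
  · exact ⟨_, mem_periodicPts_of_iterate_eq hij h⟩
  · exact ⟨_, mem_periodicPts_of_iterate_eq hij h.symm⟩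

/-- As the states `q, q a, q a ^ 2, …` outside the cycle are distinct, `a ^ (n - m)` maps every
state into the cycle. -/
theorem iterate_letterMap_mem_cycle [Fintype Q] (a : A) (q : Q) :
    (M.letterMap a)^[Fintype.card Q - (M.cycle a).ncard] q ∈ M.cycle a := by
  classical
  set N := Fintype.card Q - (M.cycle a).ncard with hN
  by_contra hq
  have hout : ∀ i ≤ N, (M.letterMap a)^[i] q ∉ M.cycle a := by
    intro i hi hmem
    have := iterate_mem_periodicPts hmem (N - i)
    rw [← Function.iterate_add_apply, Nat.sub_add_cancel hi] at this
    exact hq this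
  have hinj : Set.InjOn (fun i ↦ (M.letterMap a)^[i] q) (Set.Iic N) := by
    intro i hi j hj h
    by_contra hne
    rcases Ne.lt_or_gt hne with hij | hij
    · exact hout i hi (mem_periodicPts_of_iterate_eq hij h)
    · exact hout j hj (mem_periodicPts_of_iterate_eq hij h.symm)
  have h1 : (Set.Iic N).ncard ≤ (M.cycle a)ᶜ.ncard :=
    Set.ncard_le_ncard_of_injOn _ hout hinj (Set.toFinite _)
  have h2 := Set.ncard_add_ncard_compl (M.cycle a)
  have h3 : (Set.Iic N).ncard = N + 1 := by
    rw [← Finset.coe_Iic, Set.ncard_coe_finset, Nat.card_Iic]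
  rw [Nat.card_eq_fintype_card] at h2
  omega

theorem IsOneClusterLetter.exists_iterate_eq {M : Automaton Q A} {a : A}
    (ha : M.IsOneClusterLetter a) {c s : Q} (hc : c ∈ M.cycle a) (hs : s ∈ M.cycle a) :
    ∃ t < Function.minimalPeriod (M.letterMap a) c, (M.letterMap a)^[t] c = s := by
  obtain ⟨i, j, -, -, h⟩ := ha s c
  obtain ⟨l, hl, hs⟩ := hs
  refine ⟨((l * i - i) + j) % _,
    Nat.mod_lt _ (Function.minimalPeriod_pos_of_mem_periodicPts hc), ?_⟩
  rw [Function.iterate_mod_minimalPeriod_eq, Function.iterate_add_apply, ← h,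
    ← Function.iterate_add_apply, Nat.sub_add_cancel (Nat.le_mul_of_pos_left i hl)]
  exact (hs.mul_const i).eq

theorem IsOneClusterLetter.ncard_cycle {M : Automaton Q A} {a : A}
    (ha : M.IsOneClusterLetter a) {c : Q} (hc : c ∈ M.cycle a) :
    (M.cycle a).ncard = Function.minimalPeriod (M.letterMap a) c := by
  have himg : M.cycle a = (fun t ↦ (M.letterMap a)^[t] c) ''
      Set.Iio (Function.minimalPeriod (M.letterMap a) c) := by
    ext s
    constructor
    · exact fun hs ↦ ha.exists_iterate_eq hc hs
    · rintro ⟨t, -, rfl⟩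
      exact iterate_mem_periodicPts hc t
  rw [himg, Function.iterate_injOn_Iio_minimalPeriod.ncard_image, ← Finset.coe_Iio,
    Set.ncard_coe_finset, Nat.card_Iio]

/-! ### Chains of extensions -/

open Finset Classical in
/-- The first extension starts from a single state of the cycle. As this state may be replaced by
any other one of the cycle, the power of `a` at the end of the word is taken as `a ^ N`. -/
theorem exists_first_extension [Fintype Q] (hM : M.IsSynchronizing) (a : A) {c : Q} {m N : ℕ}
    (hm : 1 < m) (hc : Function.minimalPeriod (M.letterMap a) c = m)
    (hN : ∀ q, ∃ t, (M.letterMap a)^[N] q = (M.letterMap a)^[t] c) :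
    ∃ (r : Q) (w : List A), w.length + m ≤ Fintype.card Q + N + 1 ∧
      2 ≤ #{t ∈ range m | M.run ((M.letterMap a)^[t] c) w = r} := by
  have hper : (M.letterMap a)^[m] c = c := hc ▸ Function.iterate_minimalPeriod
  have hone : #{t ∈ range m | (M.letterMap a)^[t] c ∈ ({c} : Set Q)} = 1 := by
    rw [card_eq_one]
    refine ⟨0, ?_⟩
    ext t
    simp only [mem_filter, mem_range, Set.mem_singleton_iff, mem_singleton]
    constructor
    · rintro ⟨ht, h⟩
      refine Function.iterate_injOn_Iio_minimalPeriod (f := M.letterMap a) (x := c) ?_ ?_ h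
      · exact hc ▸ ht
      · exact hc ▸ (by omega : 0 < m)
    · rintro rfl
      exact ⟨by omega, rfl⟩
  obtain ⟨u, j, d, p, h, κ, hph, hκh, hd, hu, hj, hlt⟩ :=
    M.exists_extension hM a (by omega) hper hN {c} 1 hone one_pos hm
  rw [min_eq_left (by omega), mul_eq_one] at hκh
  obtain ⟨rfl, rfl⟩ := hκh
  rw [mul_one] at hph
  subst hph
  refine ⟨(M.letterMap a)^[p - j] c, u ++ List.replicate N a, ?_, ?_⟩
  · simp only [List.length_append, List.length_replicate]
    omega
  · refine Nat.succ_le_of_lt (hlt.trans_le (card_le_card fun t ht ↦ ?_))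
    rw [mem_filter] at ht ⊢
    refine ⟨ht.1, ?_⟩
    rw [run_append, run_replicate]
    obtain ⟨i, hi⟩ := hN (M.run ((M.letterMap a)^[t] c) u)
    have h1 := ht.2
    rw [add_comm N, Function.iterate_add_apply, hi, Set.mem_singleton_iff] at h1
    rw [hi]
    nth_rw 2 [← h1]
    rw [← Function.iterate_add_apply, Nat.sub_add_cancel hj.le, ← Function.iterate_add_apply,
      add_comm p i, Function.iterate_add_apply, hper]

open Finset Classical in
/-- Iterated extensions: some word of controlled length sends at least `k` states of the cycle to one state.
An extension may add several states at once; the bound is then kept, as its summands are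
nonnegative. -/
theorem exists_word_card_fiber_ge [Fintype Q] (hM : M.IsSynchronizing) (a : A) {c : Q} {m N : ℕ}
    (hc : Function.minimalPeriod (M.letterMap a) c = m) (hmN : N + m = Fintype.card Q)
    (hN : ∀ q, ∃ t, (M.letterMap a)^[N] q = (M.letterMap a)^[t] c) (k : ℕ) (hk : 2 ≤ k)
    (hkm : k ≤ m) :
    ∃ (r : Q) (w : List A), k ≤ #{t ∈ range m | M.run ((M.letterMap a)^[t] c) w = r} ∧
      (w.length : ℝ) ≤ 2 * N + 1 + ∑ i ∈ Ico 2 k,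
        (2 * (Fintype.card Q : ℝ) - 2 * m / ((min i (m - i) : ℕ) + 1)) := by
  have hper : (M.letterMap a)^[m] c = c := hc ▸ Function.iterate_minimalPeriod
  induction k, hk using Nat.le_induction with
  | base =>
    obtain ⟨r, w, hw, h2⟩ := M.exists_first_extension hM a (by omega) hc hN
    refine ⟨r, w, h2, ?_⟩
    have : w.length ≤ 2 * N + 1 := by omega
    simpa using (by exact_mod_cast this : (w.length : ℝ) ≤ 2 * N + 1)
  | succ k hk ih =>
    obtain ⟨r, w, hkc, hw⟩ := ih (by omega)
    rw [sum_Ico_succ_top hk]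
    rcases hkc.lt_or_eq with hlt | heq
    · refine ⟨r, w, hlt, hw.trans ?_⟩
      rw [← add_assoc, le_add_iff_nonneg_right, sub_nonneg, div_le_iff₀ (by positivity)]
      have h1 : (m : ℝ) ≤ Fintype.card Q := by exact_mod_cast (by omega : m ≤ Fintype.card Q)
      have h2 : (0 : ℝ) ≤ Fintype.card Q * (min k (m - k) : ℕ) := by positivity
      nlinarith
    · obtain ⟨u, j, d, p, h, κ, hph, hκh, hd, hu, hj, hlt⟩ :=
        M.exists_extension hM a (by omega) hper hN {q | M.run q w = r} k heq.symm (by omega)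
          (by omega)
      have hpos : 0 < κ * h := by
        rw [hκh]
        omega
      have hcost := extension_cost_le (Nat.pos_of_mul_pos_right hpos)
        (Nat.pos_of_mul_pos_left hpos) hd
      rw [hκh, hph] at hcost
      refine ⟨r, u ++ List.replicate (N + j) a ++ w, ?_, ?_⟩
      · simp only [run_append, run_replicate]
        exact hlt
      · have h1 : u.length + d + j + 1 ≤ Fintype.card Q + 1 + p := by omega
        have h2 : (u.length : ℝ) + d + j + 1 ≤ Fintype.card Q + 1 + p := by exact_mod_cast h1
        have h3 : (N : ℝ) + m = Fintype.card Q := by exact_mod_cast hmN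
        simp only [List.length_append, List.length_replicate, Nat.cast_add]
        linarith

end Automaton

theorem corollary1 {Q A : Type*} [Fintype Q] (M : Automaton Q A) (hM : M.IsSynchronizing)
    (a : A) (ha : M.IsOneClusterLetter a) (n m : ℕ) (hn : n = Fintype.card Q)
    (hm : m = (M.cycle a).ncard) :
    ∃ w : List A, M.IsResetWord w ∧
      (w.length : ℝ) ≤
        2 * (n : ℝ) * (m : ℝ) - 4 * (m : ℝ) * Real.log (((m : ℝ) + 3) / 2)
          + 2 * (m : ℝ) - (n : ℝ) + 1 := by
  classical
  have hne : Nonempty Q := hM.elim fun _ ⟨r, _⟩ ↦ ⟨r⟩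
  obtain ⟨c, hcC⟩ := M.cycle_nonempty a
  have hc : Function.minimalPeriod (M.letterMap a) c = m := by rw [hm, ha.ncard_cycle hcC]
  have hm0 : 0 < m := hc ▸ Function.minimalPeriod_pos_of_mem_periodicPts hcC
  obtain ⟨N, hN⟩ : ∃ N, N + m = n := by
    have := Set.ncard_le_card (M.cycle a)
    rw [Nat.card_eq_fintype_card] at this
    exact ⟨n - m, by omega⟩
  have hcyc : ∀ q, ∃ t < m, (M.letterMap a)^[N] q = (M.letterMap a)^[t] c := by
    intro q
    have h1 := M.iterate_letterMap_mem_cycle a q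
    rw [← hn, ← hm, show n - m = N by omega] at h1
    obtain ⟨t, ht, h⟩ := ha.exists_iterate_eq hcC h1
    exact ⟨t, hc ▸ ht, h.symm⟩
  have hNR : (N : ℝ) + m = n := by exact_mod_cast hN
  have hlog := two_mul_log_sub_one_le_sum m hm0
  rcases (show 1 ≤ m from hm0).eq_or_lt with rfl | hm1
  · refine ⟨List.replicate N a, ⟨c, fun q ↦ ?_⟩, ?_⟩
    · rw [Automaton.run_replicate]
      obtain ⟨t, ht, h⟩ := hcyc q
      obtain rfl : t = 0 := by omega
      exact h
    · simp only [List.length_replicate]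
      simp only [Finset.Ico_self, Finset.sum_empty] at hlog
      push_cast at *
      have : (0 : ℝ) ≤ N := by positivity
      linarith
  · obtain ⟨r, w, hr, hw⟩ := M.exists_word_card_fiber_ge hM a hc (hN.trans hn)
      (fun q ↦ (hcyc q).imp fun _ h ↦ h.2) m hm1 le_rfl
    refine ⟨List.replicate N a ++ w, ⟨r, fun q ↦ ?_⟩, ?_⟩
    · rw [Automaton.run_append, Automaton.run_replicate]
      obtain ⟨t, ht, h⟩ := hcyc q
      have hall := (Finset.card_filter_eq_iff (s := Finset.range m)).1
        ((Finset.card_filter_le _ _).antisymm (by simpa using hr))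
      rw [h]
      exact hall _ (Finset.mem_range.2 ht)
    · rw [← hn, Finset.sum_sub_distrib] at hw
      rw [Finset.sum_eq_sum_Ico_succ_bot hm1, min_eq_left (by omega)] at hlog
      have h1 : ∑ i ∈ Finset.Ico 2 m, 2 * (m : ℝ) / ((min i (m - i) : ℕ) + 1) =
          2 * m * ∑ i ∈ Finset.Ico 2 m, 1 / ((min i (m - i) : ℕ) + 1 : ℝ) := by
        rw [Finset.mul_sum]
        refine Finset.sum_congr rfl fun i _ ↦ ?_
        ring
      rw [h1, Finset.sum_const, Nat.card_Ico, nsmul_eq_mul, Nat.cast_sub hm1] at hw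
      have h2 := mul_le_mul_of_nonneg_left hlog (by positivity : (0 : ℝ) ≤ 2 * m)
      simp only [List.length_append, List.length_replicate]
      push_cast at *
      nlinarith
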